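/- Consider a route of $L\ge 2$ reconfigurable intelligent surfaces (RISs) with $N_1,\dots,N_L\ge 1$ elements, transmit power $P_t>0$, antenna gain product $G=G_tG_r>0$, noise power $\sigma^2>0$ and path loss $l_c=\prod_{i=1}^{L+1}C_0(d_i/d_0)^{-n_i}$ (with $C_0,d_0,d_i>0$, $n_i\in\mathbb R$). For $k\in\{1,L\}$ let $m_k,\Omega_k>0$ be the Nakagami shape and spread parameters of the fading at the $k$-th RIS, let $\kappa_k\ge 0$ be the concentration of its von Mises distributed phase errors, and put $$\bar\Omega_k=t_{1}^2\Big(\frac{\Gamma(m_k+\frac12)}{\Gamma(m_k)}\sqrt{\frac{\Omega_k}{m_k}}\Big)^2,\qquad \bar m_k=\frac{N_k\bar\Omega_k}{2+2t_2-4\bar\Omega_k},\qquad t_n=\frac{I_n(\kappa_k)}{I_0(\kappa_k)},$$ where $I_n$ is the modified Bessel function of the first kind; assume $\bar m_1,\bar m_L>0$. Let $Z_1,Z_L$ be independent random variables such that $Z_k$ has the Nakagami distribution with shape $\bar m_k$ and spread $\bar\Omega_k$, i.e. the density $\frac{2\bar m_k^{\bar m_k}}{\Gamma(\bar m_k)\bar\Omega_k^{\bar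 m_k}}x^{2\bar m_k-1}e^{-\bar m_kx^2/\bar\Omega_k}$ on $x>0$. In the double-Nakagami approximation the received SNR is $$\gamma_r=\frac{P_t}{\sigma^2}\,l_c\,G\,\Big(\prod_{i=1}^{L}N_i\;Z_1Z_L\Big)^2 .$$ Then $\sqrt{\gamma_r}$ has a probability density $f$, and for all $\alpha\in\mathbb R$ and $\beta>0$ the average symbol error probability $$A_c=\int_0^\infty \alpha\,Q(\sqrt{\beta}\,x)\,f(x)\,dx,\qquad Q(x)=\tfrac12\operatorname{erfc}(x/\sqrt2),$$ of a modulation whose symbol error probability at SNR $x^2$ is $\alpha Q(\sqrt\beta x)$ is an absolutely convergent integral and equals $$A_c=\frac{\alpha}{2\sqrt{\pi}\,\Gamma(\bar m_1)\Gamma(\bar m_L)}\;G^{2,2}_{3,2}\!\left(\frac{\beta P_tGl_c\prod_{i=1}^{L}N_i^2}{2\sigma^2\,\frac{\bar m_1\bar m_L}{\bar\Omega_1\bar\Omega_L}}\;\middle|\;\begin{matrix}1-\bar m_1,\,1-\bar m_L,\,1\\ 0,\,\tfrac12\end{matrix}\right).$$ Here $G^{2,2}_{3,2}$ is the Meijer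 $G$-function, given by the Mellin–Barnes integral along any vertical line separating the two families of poles; such lines exist, and along each of them the integral converges absolutely and to the same value. In particular this holds with the constants $(\alpha,\beta)=(1,2)$ for BPSK, $(2,1)$ for QPSK, $(2,\,2\sin^2(\pi/M))$ for $M$-PSK and $(4,\,3/(M-1))$ for $M$-QAM ($M\ge 2$), for each of which $\beta>0$. -/

import Mathlib

open MeasureTheory ProbabilityTheory

noncomputable section

namespace CascadedRIS

/-! ### Special functions -/

/-- Complementary error function. -/
def erfc (x : ℝ) : ℝ := 2 / √Real.pi * ∫ t in Set.Ioi x, Real.exp (-t ^ 2)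

/-- Gaussian Q-function. -/
def gaussianQ (x : ℝ) : ℝ := 1 / 2 * erfc (x / √2)

/-- Modified Bessel function of the first kind of integer order `n`. -/
def besselI (n : ℕ) (x : ℝ) : ℝ :=
  1 / Real.pi * ∫ θ in (0 : ℝ)..Real.pi, Real.exp (x * Real.cos θ) * Real.cos (n * θ)

/-! ### The Meijer G-function -/

/-- The Mellin-Barnes integrand of `G^{m,n}_{p,q}(z | a; b)`. -/
def meijerIntegrand (m n : ℕ) {p q : ℕ} (a : Fin p → ℂ) (b : Fin q → ℂ) (z s : ℂ) : ℂ :=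
  (∏ j : Fin q, if (j : ℕ) < m then Complex.Gamma (b j - s)
      else (Complex.Gamma (1 - b j + s))⁻¹) *
  (∏ j : Fin p, if (j : ℕ) < n then Complex.Gamma (1 - a j + s)
      else (Complex.Gamma (a j - s))⁻¹) * z ^ s

/-- The upward line `Re s = c` separates the poles of the `Γ(b_j - s)`, `j ≤ m`, which lie on its
right, from the poles of the `Γ(1 - a_j + s)`, `j ≤ n`, which lie on its left. -/
def SeparatesPoles (m n : ℕ) {p q : ℕ} (a : Fin p → ℂ) (b : Fin q → ℂ) (c : ℝ) : Prop :=
  (∀ j : Fin q, (j : ℕ) < m → c < (b j).re) ∧ (∀ j : Fin p, (j : ℕ) < n → (a j).re - 1 < c)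

/-- `(2πi)⁻¹ ∫ meijerIntegrand ds` along the upward line `Re s = c`, with `s = c + i t`. -/
def meijerLine (m n : ℕ) {p q : ℕ} (a : Fin p → ℂ) (b : Fin q → ℂ) (z : ℂ) (c : ℝ) : ℂ :=
  1 / (2 * Real.pi) * ∫ t : ℝ, meijerIntegrand m n a b z (c + t * Complex.I)

open Classical in
/-- The Meijer G-function `G^{m,n}_{p,q}(z | a; b)`, as the Mellin-Barnes integral along a vertical
line that separates the two families of poles (junk value `0` if there is no such line). -/
def meijerG (m n : ℕ) {p q : ℕ} (a : Fin p → ℂ) (b : Fin q → ℂ) (z : ℂ) : ℂ :=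
  if h : ∃ c : ℝ, SeparatesPoles m n a b c then meijerLine m n a b z h.choose else 0

/-- The integral that defines `G^{m,n}_{p,q}(z | a; b)` makes sense: there is a separating line,
and on each of these the integral converges absolutely, to the same value. -/
def MeijerGDefined (m n : ℕ) {p q : ℕ} (a : Fin p → ℂ) (b : Fin q → ℂ) (z : ℂ) : Prop :=
  (∃ c : ℝ, SeparatesPoles m n a b c) ∧
  ∀ c : ℝ, SeparatesPoles m n a b c →
    Integrable (fun t : ℝ => meijerIntegrand m n a b z (c + t * Complex.I)) ∧
    meijerLine m n a b z c = meijerG m n a b z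

/-! ### Distributions -/

/-- Density of the Nakagami-`m` distribution with shape parameter `m` and spread parameter `w`. -/
def nakagamiPDF (m w x : ℝ) : ℝ :=
  if 0 < x then
    2 * m ^ m / (Real.Gamma m * w ^ m) * x ^ (2 * m - 1) * Real.exp (-(m / w) * x ^ 2)
  else 0

/-- The Nakagami-`m` distribution with shape parameter `m` and spread parameter `w`. -/
def nakagami (m w : ℝ) : Measure ℝ :=
  volume.withDensity fun x => ENNReal.ofReal (nakagamiPDF m w x)

/-- The von Mises distribution on `(-π, π]` with mean `0` and concentration parameter `κ`. -/
def vonMises (κ : ℝ) : Measure ℝ :=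
  (volume.restrict (Set.Ioc (-Real.pi) Real.pi)).withDensity fun x =>
    ENNReal.ofReal (Real.exp (κ * Real.cos x) / (2 * Real.pi * besselI 0 κ))

/-- The `n`-th trigonometric moment `I_n(κ) / I_0(κ)` of the von Mises distribution. -/
def trigMoment (κ : ℝ) (n : ℕ) : ℝ := besselI n κ / besselI 0 κ

theorem besselI_zero_pos (κ : ℝ) : 0 < besselI 0 κ := by
  unfold besselI
  have : 0 < ∫ θ in (0 : ℝ)..Real.pi, Real.exp (κ * Real.cos θ) * Real.cos ((0 : ℕ) * θ) := by
    apply intervalIntegral.intervalIntegral_pos_of_pos_on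
    · apply Continuous.intervalIntegrable; fun_prop
    · intro x _; simp; positivity
    · exact Real.pi_pos
  positivity

/-- `trigMoment κ n` is indeed `E[exp(i n φ)]` for a von Mises distributed phase `φ`. -/
theorem integral_vonMises (κ : ℝ) (n : ℕ) :
    ∫ φ, Complex.exp (Complex.I * n * φ) ∂(vonMises κ) = (trigMoment κ n : ℂ) := by
  have hI := besselI_zero_pos κ
  have hpi := Real.pi_pos
  unfold vonMises
  rw [integral_withDensity_eq_integral_toReal_smul (by fun_prop) (by simp)]
  rw [← intervalIntegral.integral_of_le (by linarith)]
  have e : ∀ φ : ℝ, (ENNReal.ofReal (Real.exp (κ * Real.cos φ) /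
      (2 * Real.pi * besselI 0 κ))).toReal • Complex.exp (Complex.I * n * φ)
      = (((2 * Real.pi * besselI 0 κ)⁻¹ : ℝ) : ℂ) *
        (((Real.exp (κ * Real.cos φ) * Real.cos (n * φ) : ℝ) : ℂ) +
        ((Real.exp (κ * Real.cos φ) * Real.sin (n * φ) : ℝ) : ℂ) * Complex.I) := by
    intro φ
    rw [ENNReal.toReal_ofReal (by positivity), Complex.real_smul,
      show Complex.I * n * φ = ((n * φ : ℝ) : ℂ) * Complex.I by push_cast; ring, Complex.exp_mul_I,
      ← Complex.ofReal_cos, ← Complex.ofReal_sin]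
    push_cast
    ring
  simp_rw [e]
  have c1 : Continuous fun φ : ℝ => Real.exp (κ * Real.cos φ) * Real.cos (n * φ) := by fun_prop
  have c2 : Continuous fun φ : ℝ => Real.exp (κ * Real.cos φ) * Real.sin (n * φ) := by fun_prop
  have i1 : IntervalIntegrable (fun φ : ℝ => ((Real.exp (κ * Real.cos φ) * Real.cos (n * φ) : ℝ) : ℂ))
      volume (-Real.pi) Real.pi := (Complex.continuous_ofReal.comp c1).intervalIntegrable _ _
  have i2 : IntervalIntegrable (fun φ : ℝ =>
      ((Real.exp (κ * Real.cos φ) * Real.sin (n * φ) : ℝ) : ℂ) * Complex.I)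
      volume (-Real.pi) Real.pi :=
    ((Complex.continuous_ofReal.comp c2).mul continuous_const).intervalIntegrable _ _
  rw [intervalIntegral.integral_const_mul, intervalIntegral.integral_add i1 i2,
    intervalIntegral.integral_mul_const, intervalIntegral.integral_ofReal,
    intervalIntegral.integral_ofReal]
  have s2 : ∫ φ in (-Real.pi)..Real.pi, Real.exp (κ * Real.cos φ) * Real.sin (n * φ) = 0 := by
    have := intervalIntegral.integral_comp_neg
      (fun φ => Real.exp (κ * Real.cos φ) * Real.sin (n * φ)) (a := -Real.pi) (b := Real.pi)
    simp only [Real.cos_neg, mul_neg, Real.sin_neg, neg_neg, intervalIntegral.integral_neg] at this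
    linarith
  have s1 : ∫ φ in (-Real.pi)..Real.pi, Real.exp (κ * Real.cos φ) * Real.cos (n * φ)
      = 2 * ∫ φ in (0 : ℝ)..Real.pi, Real.exp (κ * Real.cos φ) * Real.cos (n * φ) := by
    have := intervalIntegral.integral_comp_neg
      (fun φ => Real.exp (κ * Real.cos φ) * Real.cos (n * φ)) (a := 0) (b := Real.pi)
    simp only [Real.cos_neg, mul_neg, neg_zero] at this
    rw [← intervalIntegral.integral_add_adjacent_intervals (c1.intervalIntegrable _ 0)
      (c1.intervalIntegrable 0 _), ← this]
    ring
  rw [s1, s2, Complex.ofReal_zero, zero_mul, add_zero, ← Complex.ofReal_mul]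
  congr 1
  unfold trigMoment
  have : ∫ φ in (0 : ℝ)..Real.pi, Real.exp (κ * Real.cos φ) * Real.cos (n * φ)
      = Real.pi * besselI n κ := by
    unfold besselI; field_simp
  rw [this]
  field_simp

/-- Spread parameter of the Nakagami amplitude `Z_k` of one imperfectly configured RIS whose
phase errors have concentration `κ` and whose fading has shape `m` and spread `w`. -/
def spreadBar (κ m w : ℝ) : ℝ :=
  trigMoment κ 1 ^ 2 * (Real.Gamma (m + 1 / 2) / Real.Gamma m * √(w / m)) ^ 2

/-- Shape parameter of `Z_k`, for an RIS with `N` elements. -/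
def shapeBar (N : ℕ) (κ m w : ℝ) : ℝ :=
  N * spreadBar κ m w / (2 + 2 * trigMoment κ 2 - 4 * spreadBar κ m w)

/-! ### The network -/

/-- The deterministic parameters of a cascaded RIS network. The RISs of the route are numbered
`1, …, L` and its links `1, …, L + 1`; values at other indices are not used. -/
structure Network where
  /-- number of RISs -/
  L : ℕ
  two_le_L : 2 ≤ L
  /-- numbers of reflecting elements -/
  N : ℕ → ℕ
  N_pos : ∀ i ∈ Finset.Icc 1 L, 0 < N i
  /-- fading shape parameters of the first and the last link -/
  m₁ : ℝ
  mL : ℝ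
  m₁_pos : 0 < m₁
  mL_pos : 0 < mL
  /-- fading spread parameters of the first and the last link -/
  w₁ : ℝ
  wL : ℝ
  w₁_pos : 0 < w₁
  wL_pos : 0 < wL
  /-- phase error concentration parameters of the first and the last RIS -/
  κ₁ : ℝ
  κL : ℝ
  κ₁_nonneg : 0 ≤ κ₁
  κL_nonneg : 0 ≤ κL
  /-- transmit power -/
  Pt : ℝ
  Pt_pos : 0 < Pt
  /-- antenna gains of the transmitter and the receiver -/
  Gt : ℝ
  Gr : ℝ
  Gt_pos : 0 < Gt
  Gr_pos : 0 < Gr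
  /-- the noise power is `σ ^ 2` -/
  σ : ℝ
  σ_pos : 0 < σ
  /-- path loss at the reference distance `d₀` -/
  C₀ : ℝ
  d₀ : ℝ
  C₀_pos : 0 < C₀
  d₀_pos : 0 < d₀
  /-- lengths and path loss exponents of the links -/
  d : ℕ → ℝ
  n : ℕ → ℝ
  d_pos : ∀ i ∈ Finset.Icc 1 (L + 1), 0 < d i

namespace Network

variable (R : Network)

/-- Product of the antenna gains. -/
def G : ℝ := R.Gt * R.Gr

/-- Total path loss of the route. -/
def lc : ℝ := ∏ i ∈ Finset.Icc 1 (R.L + 1), R.C₀ * (R.d i / R.d₀) ^ (-R.n i)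

/-- Spread parameter of `Z_1`. -/
def wBar₁ : ℝ := spreadBar R.κ₁ R.m₁ R.w₁

/-- Spread parameter of `Z_L`. -/
def wBarL : ℝ := spreadBar R.κL R.mL R.wL

/-- Shape parameter of `Z_1`. -/
def mBar₁ : ℝ := shapeBar (R.N 1) R.κ₁ R.m₁ R.w₁

/-- Shape parameter of `Z_L`. -/
def mBarL : ℝ := shapeBar (R.N R.L) R.κL R.mL R.wL

/-- Instantaneous received SNR when the amplitudes of the first and the last RIS are `z₁`, `zL`. -/
def snr (z₁ zL : ℝ) : ℝ :=
  R.Pt / R.σ ^ 2 * R.lc * R.G * ((∏ i ∈ Finset.Icc 1 R.L, (R.N i : ℝ)) * z₁ * zL) ^ 2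

end Network

/-! ### Symbol error probabilities -/

/-- The average, over a random received amplitude `X` with a density (so that `X ^ 2` is the
instantaneous SNR), of the symbol error probability `α Q(√β x)`. -/
def averageSEP {S : Type*} [MeasurableSpace S] (P : Measure S) (X : S → ℝ) (α β : ℝ) : ℝ :=
  ∫ x in Set.Ioi 0, α * gaussianQ (√β * x) * (pdf X P volume x).toReal

/-- Modulation schemes; `M` is the size of the constellation. -/
inductive Modulation where
  | bpsk
  | qpsk
  | mpsk (M : ℕ) (hM : 2 ≤ M)
  | mqam (M : ℕ) (hM : 2 ≤ M)

/-- The modulation constant `α`. -/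
def Modulation.alpha : Modulation → ℝ
  | bpsk => 1
  | qpsk => 2
  | mpsk _ _ => 2
  | mqam _ _ => 4

/-- The modulation constant `β`. -/
def Modulation.beta : Modulation → ℝ
  | bpsk => 2
  | qpsk => 1
  | mpsk M _ => 2 * Real.sin (Real.pi / M) ^ 2
  | mqam M _ => 3 / ((M : ℝ) - 1)

end CascadedRIS

end

open CascadedRIS

namespace CascadedRIS

/-! Almost surely `X = √A * Z₁ * ZL`, so the error probability is `α / 2` times the mean of `erfc
√Y` with `Y = k Z₁² Z_L²` and `k = β A / 2`. Mellin inversion writes `√π erfc √u` as `(2πi)⁻¹ ∫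
Γ(1/2 - s) / (-s) u ^ s ds` over any line `Re s = c < 0` (`erfc_sqrt_eq_mellinBarnes`). Taking
expectations replaces `u ^ s` by `E[Y ^ s]`, which by independence is `k ^ s` times two Nakagami
moments `Γ(m + s) / Γ(m) (Ω / m) ^ s`, finite for `Re s > -m` (`integral_mul_sq_cpow`). As `Γ(-s) /
Γ(1 - s) = 1 / (-s)`, the result is exactly the Meijer integrand (`meijerIntegrand_eq`).

Fubini applies because `|Y ^ (c + i t)| = Y ^ c` does not depend on `t` and the kernel decays like
`t⁻²`. The conditions on `c` are precisely those of a separating line, and on each such line the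
value is the same expectation; no contour has to be shifted. -/

theorem integral_cpow_mul_exp_neg_mul_sq {r : ℝ} (hr : 0 < r) {w : ℂ} (hw : 0 < w.re) :
    ∫ x in Set.Ioi (0 : ℝ), (x : ℂ) ^ (2 * w - 1) * Real.exp (-r * x ^ 2) =
      1 / 2 * ((1 / r : ℂ) ^ w * Complex.Gamma w) := by
  have h := mellin_comp_rpow (fun t : ℝ => (Real.exp (-r * t) : ℂ)) (2 * w) 2
  have h2 : (2 * w / ((2 : ℝ) : ℂ)) = w := by push_cast; field_simp
  rw [h2] at h
  simp only [mellin, smul_eq_mul, Real.rpow_two] at h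
  rw [h]
  have h3 := Complex.integral_cpow_mul_exp_neg_mul_Ioi (a := w) (r := r) hw (by simpa using hr)
  rw [← h3]
  simp

theorem integrableOn_rpow_mul_exp_neg_mul_sq_Ioi {r : ℝ} (hr : 0 < r) {a : ℝ} (ha : 0 < a) :
    IntegrableOn (fun x : ℝ => x ^ (2 * a - 1) * Real.exp (-r * x ^ 2)) (Set.Ioi 0) := by
  have := integrableOn_rpow_mul_exp_neg_mul_rpow (p := 2) (s := 2 * a - 1) (b := r)
    (by linarith) (by norm_num) hr
  simpa only [Real.rpow_two] using this

theorem integrable_exp_neg_sq : Integrable fun t : ℝ => Real.exp (-t ^ 2) := by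
  simpa using integrable_exp_neg_mul_sq (b := 1) one_pos

/-! ### The complementary error function and its Mellin transform -/

theorem continuous_erfc : Continuous erfc := by
  have h : erfc = fun x => 2 / √Real.pi * ((∫ t in Set.Ioi (0 : ℝ), Real.exp (-t ^ 2)) -
      ∫ t in (0 : ℝ)..x, Real.exp (-t ^ 2)) := by
    funext x
    unfold erfc
    rw [← intervalIntegral.integral_Ioi_sub_Ioi' integrable_exp_neg_sq.integrableOn
      integrable_exp_neg_sq.integrableOn]
    simp
  rw [h]
  have := intervalIntegral.continuous_primitive
    (fun a b => integrable_exp_neg_sq.intervalIntegrable (a := a) (b := b)) 0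
  fun_prop

theorem erfc_nonneg (x : ℝ) : 0 ≤ erfc x := by
  unfold erfc
  have : 0 ≤ ∫ t in Set.Ioi x, Real.exp (-t ^ 2) := integral_nonneg fun t => by positivity
  positivity

theorem erfc_le_two (x : ℝ) : erfc x ≤ 2 := by
  unfold erfc
  have h : ∫ t in Set.Ioi x, Real.exp (-t ^ 2) ≤ √Real.pi := by
    calc _ ≤ ∫ t, Real.exp (-t ^ 2) :=
          setIntegral_le_integral integrable_exp_neg_sq (.of_forall fun t => by positivity)
      _ = _ := by simpa using integral_gaussian 1
  have hp : 0 < √Real.pi := by positivity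
  calc _ ≤ 2 / √Real.pi * √Real.pi := by gcongr
    _ = 2 := by field_simp

theorem integral_cpow_Ioo {w : ℂ} (hw : 0 < w.re) {a : ℝ} (ha : 0 < a) :
    IntegrableOn (fun u : ℝ => (u : ℂ) ^ (w - 1)) (Set.Ioo 0 a) ∧
    ∫ u in Set.Ioo 0 a, (u : ℂ) ^ (w - 1) = (a : ℂ) ^ w / w := by
  have hw' : -1 < (w - 1).re := by simpa using hw
  have hw0 : w ≠ 0 := by rintro rfl; simp at hw
  constructor
  · have := (intervalIntegral.intervalIntegrable_cpow' (a := 0) (b := a) hw')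
    rw [intervalIntegrable_iff_integrableOn_Ioo_of_le ha.le] at this
    exact this
  · rw [← integral_Ioc_eq_integral_Ioo, ← intervalIntegral.integral_of_le ha.le,
      integral_cpow (Or.inl hw')]
    simp [hw0]

/-- The double integrand of the Mellin transform of `u ↦ erfc √u`. -/
noncomputable def erfcKernel (w : ℂ) (u t : ℝ) : ℂ :=
  if u < t ^ 2 then (u : ℂ) ^ (w - 1) * Real.exp (-t ^ 2) else 0

theorem measurable_erfcKernel (w : ℂ) : Measurable (Function.uncurry (erfcKernel w)) := by
  unfold erfcKernel Function.uncurry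
  refine Measurable.ite (measurableSet_lt (by fun_prop) (by fun_prop)) ?_ (by fun_prop)
  exact ((by fun_prop : Measurable fun p : ℝ × ℝ => (p.1 : ℂ)).pow_const _).mul (by fun_prop)

theorem erfcKernel_eq_indicator (w : ℂ) (u : ℝ) {t : ℝ} :
    erfcKernel w u t = (Set.Iio (t ^ 2)).indicator
      (fun u : ℝ => (u : ℂ) ^ (w - 1) * Real.exp (-t ^ 2)) u := by
  simp [erfcKernel, Set.indicator_apply]

theorem integral_erfcKernel_left {w : ℂ} (hw : 0 < w.re) {t : ℝ} (ht : 0 < t) :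
    IntegrableOn (fun u => erfcKernel w u t) (Set.Ioi 0) ∧
    ∫ u in Set.Ioi 0, erfcKernel w u t =
      1 / w * ((t : ℂ) ^ (2 * (w + 1 / 2) - 1) * Real.exp (-1 * t ^ 2)) := by
  obtain ⟨h1, h2⟩ := integral_cpow_Ioo hw (a := t ^ 2) (by positivity)
  have hs : Set.Ioi 0 ∩ Set.Iio (t ^ 2) = Set.Ioo 0 (t ^ 2) := rfl
  simp only [erfcKernel_eq_indicator]
  constructor
  · rw [IntegrableOn, integrable_indicator_iff measurableSet_Iio, IntegrableOn,
      Measure.restrict_restrict measurableSet_Iio, Set.inter_comm, hs]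
    exact h1.mul_const _
  · rw [integral_indicator measurableSet_Iio, Measure.restrict_restrict measurableSet_Iio,
      Set.inter_comm, hs, integral_mul_const, h2]
    -- The exponent `2 * w` is written as `2 * (w + 1 / 2) - 1` to match
    -- `integral_cpow_mul_exp_neg_mul_sq` with `r = 1`.
    have : ((t ^ 2 : ℝ) : ℂ) ^ w = (t : ℂ) ^ (2 * (w + 1 / 2) - 1) := by
      rw [show 2 * (w + 1 / 2) - 1 = ((2 : ℕ) : ℂ) * w by push_cast; ring,
        Complex.cpow_nat_mul' (by simp [Complex.arg_ofReal_of_nonneg ht.le, Real.pi_pos])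
        (by simp [Complex.arg_ofReal_of_nonneg ht.le, Real.pi_nonneg])]
      push_cast; rfl
    rw [this]
    simp only [neg_mul, one_mul]
    ring

/-- Reduces absolute integrability to the exact evaluation at the real exponent `w.re`. -/
theorem norm_erfcKernel (w : ℂ) {u : ℝ} (hu : 0 < u) (t : ℝ) :
    ((‖erfcKernel w u t‖ : ℝ) : ℂ) = erfcKernel (w.re : ℂ) u t := by
  unfold erfcKernel
  split_ifs
  · rw [norm_mul, Complex.norm_cpow_eq_rpow_re_of_pos hu, Complex.norm_real,
      Real.norm_of_nonneg (Real.exp_nonneg _)]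
    push_cast
    rw [Complex.ofReal_cpow hu.le]
    simp
  · simp

theorem integrable_erfcKernel {w : ℂ} (hw : 0 < w.re) :
    Integrable (Function.uncurry (erfcKernel w))
      ((volume.restrict (Set.Ioi 0)).prod (volume.restrict (Set.Ioi 0))) := by
  rw [integrable_prod_iff' (measurable_erfcKernel w).aestronglyMeasurable]
  constructor
  · filter_upwards [ae_restrict_mem measurableSet_Ioi] with t ht
    exact (integral_erfcKernel_left hw ht).1
  · have h := (integrableOn_rpow_mul_exp_neg_mul_sq_Ioi one_pos (a := w.re + 1 / 2)
      (by linarith)).const_mul (1 / w.re)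
    refine h.congr ?_
    filter_upwards [ae_restrict_mem measurableSet_Ioi] with t ht
    have ht' : 0 < t := ht
    apply Complex.ofReal_injective
    have h2 : ∫ u in Set.Ioi 0, ((‖erfcKernel w u t‖ : ℝ) : ℂ) =
        ∫ u in Set.Ioi 0, erfcKernel (w.re : ℂ) u t :=
      setIntegral_congr_fun measurableSet_Ioi fun _ hu => norm_erfcKernel w hu t
    simp only [Function.uncurry]
    rw [← integral_complex_ofReal, h2, (integral_erfcKernel_left (by simpa using hw) ht').2]
    push_cast
    rw [Complex.ofReal_cpow ht'.le]
    push_cast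
    rfl

theorem integral_erfcKernel_right (w : ℂ) (u : ℝ) :
    ∫ t in Set.Ioi 0, erfcKernel w u t =
      (u : ℂ) ^ (w - 1) * ((√Real.pi / 2 * erfc √u : ℝ) : ℂ) := by
  have h : ∀ t ∈ Set.Ioi (0 : ℝ), erfcKernel w u t = (Set.Ioi √u).indicator
      (fun t => (u : ℂ) ^ (w - 1) * ((Real.exp (-t ^ 2) : ℝ) : ℂ)) t := by
    intro t ht
    have : √u < t ↔ u < t ^ 2 := Real.sqrt_lt' ht
    simp [erfcKernel, Set.indicator_apply, this]
  rw [setIntegral_congr_fun measurableSet_Ioi h, integral_indicator measurableSet_Ioi,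
    Measure.restrict_restrict measurableSet_Ioi,
    Set.inter_eq_left.2 (Set.Ioi_subset_Ioi (Real.sqrt_nonneg u)), integral_const_mul,
    integral_complex_ofReal]
  congr 2
  unfold erfc
  have hp : 0 < √Real.pi := by positivity
  field_simp

/-- Write `erfc √u` as an integral over `t > √u` and swap the order: the `u`-integral over `0 < u <
t²` gives `t ^ (2w) / w`, and the remaining Gaussian moment is a Gamma value. -/
theorem hasMellin_erfc_sqrt {w : ℂ} (hw : 0 < w.re) :
    HasMellin (fun u => ((erfc √u : ℝ) : ℂ)) w
      (1 / (√Real.pi : ℂ) * (Complex.Gamma (w + 1 / 2) / w)) := by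
  have hp : (√Real.pi : ℂ) ≠ 0 := by
    exact_mod_cast (by positivity : √Real.pi ≠ 0)
  have hi := integrable_erfcKernel hw
  have e : ∀ u ∈ Set.Ioi (0 : ℝ), (2 / (√Real.pi : ℂ)) * (∫ t in Set.Ioi 0, erfcKernel w u t) =
      (u : ℂ) ^ (w - 1) • ((erfc √u : ℝ) : ℂ) := by
    intro u _
    rw [integral_erfcKernel_right w u, smul_eq_mul]
    push_cast
    field_simp
  constructor
  · rw [MellinConvergent]
    refine IntegrableOn.congr_fun ?_ e measurableSet_Ioi
    exact hi.integral_prod_left.const_mul _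
  · rw [mellin, ← setIntegral_congr_fun measurableSet_Ioi e, integral_const_mul,
      integral_integral_swap hi,
      setIntegral_congr_fun measurableSet_Ioi fun t ht => (integral_erfcKernel_left hw ht).2,
      integral_const_mul, integral_cpow_mul_exp_neg_mul_sq one_pos (by simp; linarith)]
    simp
    field_simp

/-! ### Decay on vertical lines and Mellin inversion -/

theorem norm_Gamma_le_Gamma_re {s : ℂ} (hs : 0 < s.re) :
    ‖Complex.Gamma s‖ ≤ Real.Gamma s.re := by
  rw [Complex.Gamma_eq_integral hs, Real.Gamma_eq_integral hs, Complex.GammaIntegral]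
  refine (norm_integral_le_integral_norm _).trans_eq ?_
  refine setIntegral_congr_fun measurableSet_Ioi fun x hx => ?_
  simp only [norm_mul, Complex.norm_real, Real.norm_eq_abs, Real.abs_exp]
  rw [Complex.norm_cpow_eq_rpow_re_of_pos hx]
  simp

theorem continuous_Gamma_line {a : ℝ} (ha : 0 < a) :
    Continuous fun t : ℝ => Complex.Gamma (a + t * Complex.I) := by
  rw [continuous_iff_continuousAt]
  intro t
  refine ContinuousAt.comp (g := Complex.Gamma) ?_ (by fun_prop)
  refine (Complex.differentiableAt_Gamma _ fun m h => ?_).continuousAt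
  have := congrArg Complex.re h
  simp at this
  have hm : (0 : ℝ) ≤ m := m.cast_nonneg
  linarith

/-- One use of `Γ(z + 1) = z Γ(z)` gains a second factor of order `1 / |t|`, and the Gamma value
left over is bounded by its value on the real axis. No Stirling estimate is needed. -/
theorem integrable_Gamma_div {a : ℝ} (ha : 0 < a) :
    Integrable fun t : ℝ => Complex.Gamma (a + t * Complex.I + 1 / 2) / (a + t * Complex.I) := by
  have hre : ∀ t : ℝ, ((a : ℂ) + t * Complex.I).re = a := by simp
  have hne : ∀ t : ℝ, (a : ℂ) + t * Complex.I ≠ 0 := fun t h => by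
    have := hre t; rw [h] at this; simp at this; linarith
  have hc : Continuous fun t : ℝ =>
      Complex.Gamma (a + t * Complex.I + 1 / 2) / (a + t * Complex.I) := by
    refine Continuous.div ?_ (by fun_prop) hne
    have := continuous_Gamma_line (a := a + 1 / 2) (by linarith)
    convert this using 3
    push_cast; ring
  -- Chosen so that `|s|² = a² + t² ≥ m (1 + t²)`.
  set m := min (a ^ 2) 1
  have hm : 0 < m := by positivity
  refine Integrable.mono' (integrable_inv_one_add_sq.const_mul
    (Real.Gamma (a + 1 / 2 + 1) / m)) hc.aestronglyMeasurable (.of_forall fun t => ?_)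
  set s : ℂ := a + t * Complex.I
  have hs : s.re = a := hre t
  have hs2 : s + 1 / 2 ≠ 0 := fun h => by
    have := congrArg Complex.re h; simp [hs] at this; linarith
  have h1 : Complex.Gamma (s + 1 / 2) = Complex.Gamma (s + 1 / 2 + 1) / (s + 1 / 2) := by
    rw [Complex.Gamma_add_one _ hs2, mul_div_cancel_left₀ _ hs2]
  have h2 : ‖Complex.Gamma (s + 1 / 2 + 1)‖ ≤ Real.Gamma (a + 1 / 2 + 1) := by
    have := norm_Gamma_le_Gamma_re (s := s + 1 / 2 + 1) (by simp [hs]; linarith)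
    simpa [hs] using this
  have h3 : m * (1 + t ^ 2) ≤ ‖s‖ ^ 2 := by
    rw [Complex.sq_norm, Complex.normSq_apply, hs]
    have : s.im = t := by simp [s]
    rw [this]
    have h4 : m ≤ a ^ 2 := min_le_left _ _
    have h5 : m ≤ 1 := min_le_right _ _
    nlinarith [sq_nonneg t]
  have h4 : ‖s‖ ≤ ‖s + 1 / 2‖ := by
    rw [← sq_le_sq₀ (norm_nonneg _) (norm_nonneg _), Complex.sq_norm, Complex.sq_norm,
      Complex.normSq_apply, Complex.normSq_apply]
    simp [hs]
    nlinarith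
  have hs0 : 0 < ‖s‖ := norm_pos_iff.2 (hne t)
  have hG : 0 < Real.Gamma (a + 1 / 2 + 1) := Real.Gamma_pos_of_pos (by linarith)
  rw [h1, norm_div, norm_div, div_div]
  calc _ ≤ Real.Gamma (a + 1 / 2 + 1) / (‖s‖ * ‖s‖) := by gcongr
    _ ≤ Real.Gamma (a + 1 / 2 + 1) / (m * (1 + t ^ 2)) := by
      rw [← sq]; gcongr
    _ = _ := by field_simp

/-- The Mellin-Barnes kernel of `u ↦ √π erfc √u` on the line `Re s = c < 0`. -/
noncomputable def erfcMellin (s : ℂ) : ℂ := Complex.Gamma (1 / 2 - s) / (-s)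

theorem integrable_erfcMellin {c : ℝ} (hc : c < 0) :
    Integrable fun t : ℝ => erfcMellin (c + t * Complex.I) := by
  have h := (integrable_Gamma_div (a := -c) (by linarith)).comp_neg
  convert h using 2 with t
  unfold erfcMellin
  push_cast
  congr 2 <;> ring

theorem erfc_sqrt_eq_mellinBarnes {c : ℝ} (hc : c < 0) {u : ℝ} (hu : 0 < u) :
    ((√Real.pi * erfc √u : ℝ) : ℂ) = 1 / (2 * Real.pi) *
      ∫ t : ℝ, erfcMellin (c + t * Complex.I) * (u : ℂ) ^ (c + t * Complex.I) := by
  have hp : (√Real.pi : ℂ) ≠ 0 := by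
    exact_mod_cast (by positivity : √Real.pi ≠ 0)
  have hM : ∀ t : ℝ, mellin (fun u => ((erfc √u : ℝ) : ℂ)) (((-c : ℝ) : ℂ) + t * Complex.I) =
      1 / (√Real.pi : ℂ) * (Complex.Gamma (((-c : ℝ) : ℂ) + t * Complex.I + 1 / 2) /
        (((-c : ℝ) : ℂ) + t * Complex.I)) :=
    fun t => (hasMellin_erfc_sqrt (by simpa using hc)).2
  have h := mellinInv_mellin_eq (-c) (fun u => ((erfc √u : ℝ) : ℂ)) hu
    (hasMellin_erfc_sqrt (by simpa using hc)).1 ?_ ?_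
  · push_cast
    -- The Mellin variable is `-s`, so the line `Re = -c` is traversed with `t` negated.
    rw [← h, mellinInv, ← integral_neg_eq_self]
    simp_rw [hM]
    rw [Complex.real_smul, mul_left_comm, ← integral_const_mul]
    push_cast
    congr 2
    funext t
    rw [erfcMellin, smul_eq_mul]
    have e1 : -(-(c : ℂ) + -t * Complex.I) = c + t * Complex.I := by ring
    have e2 : -(c : ℂ) + -t * Complex.I + 1 / 2 = 1 / 2 - (c + t * Complex.I) := by ring
    have e3 : -(c : ℂ) + -t * Complex.I = - (c + t * Complex.I) := by ring
    rw [e1, e2, e3]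
    field_simp
  · unfold Complex.VerticalIntegrable
    simp_rw [hM]
    exact (integrable_Gamma_div (by linarith)).const_mul _
  · exact (Complex.continuous_ofReal.comp
      (continuous_erfc.comp Real.continuous_sqrt)).continuousAt

/-! ### Complex moments of the Nakagami distribution -/

theorem nakagamiPDF_nonneg {m w : ℝ} (hm : 0 < m) (hw : 0 < w) (x : ℝ) :
    0 ≤ nakagamiPDF m w x := by
  unfold nakagamiPDF
  have := Real.Gamma_pos_of_pos hm
  split_ifs with hx
  · positivity
  · rfl

theorem measurable_nakagamiPDF (m w : ℝ) : Measurable (nakagamiPDF m w) := by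
  unfold nakagamiPDF
  exact Measurable.ite measurableSet_Ioi (by fun_prop) (by fun_prop)

theorem nakagami_absolutelyContinuous (m w : ℝ) : nakagami m w ≪ volume :=
  withDensity_absolutelyContinuous _ _

theorem nakagami_ae_pos (m w : ℝ) : ∀ᵐ x ∂nakagami m w, 0 < x := by
  rw [nakagami, ae_withDensity_iff (measurable_nakagamiPDF m w).ennreal_ofReal]
  refine .of_forall fun x hx => ?_
  by_contra h
  simp [nakagamiPDF, h] at hx

theorem ofReal_sq_cpow {x : ℝ} (hx : 0 < x) (s : ℂ) :
    ((x ^ 2 : ℝ) : ℂ) ^ s = (x : ℂ) ^ (2 * s) := by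
  rw [show 2 * s = ((2 : ℕ) : ℂ) * s by push_cast; ring,
    Complex.cpow_nat_mul' (by simp [Complex.arg_ofReal_of_nonneg hx.le, Real.pi_pos])
    (by simp [Complex.arg_ofReal_of_nonneg hx.le, Real.pi_nonneg])]
  push_cast; rfl

theorem nakagami_moment_integrand {m w : ℝ} (s : ℂ) {x : ℝ} (hx : 0 < x) :
    nakagamiPDF m w x • ((x ^ 2 : ℝ) : ℂ) ^ s =
      ((2 * m ^ m / (Real.Gamma m * w ^ m) : ℝ) : ℂ) *
        ((x : ℂ) ^ (2 * (m + s) - 1) * Real.exp (-(m / w) * x ^ 2)) := by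
  have hx0 : (x : ℂ) ≠ 0 := by exact_mod_cast hx.ne'
  rw [ofReal_sq_cpow hx, nakagamiPDF, if_pos hx, Complex.real_smul,
    show 2 * (m + s) - 1 = (2 * m - 1) + 2 * s by ring, Complex.cpow_add _ _ hx0]
  push_cast
  rw [Complex.ofReal_cpow hx.le]
  push_cast
  ring

theorem integrable_and_integral_nakagami_iff {m w : ℝ} (hm : 0 < m) (hw : 0 < w) (f : ℝ → ℂ) :
    (Integrable f (nakagami m w) ↔
      IntegrableOn (fun x => nakagamiPDF m w x • f x) (Set.Ioi 0)) ∧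
    ∫ x, f x ∂nakagami m w = ∫ x in Set.Ioi 0, nakagamiPDF m w x • f x := by
  have hs : Function.support (fun x => nakagamiPDF m w x • f x) ⊆ Set.Ioi 0 := by
    intro x hx
    by_contra h
    have h' : ¬ 0 < x := h
    simp [nakagamiPDF, h'] at hx
  have e : (fun x => (ENNReal.ofReal (nakagamiPDF m w x)).toReal • f x) =
      fun x => nakagamiPDF m w x • f x := by
    funext x
    rw [ENNReal.toReal_ofReal (nakagamiPDF_nonneg hm hw x)]
  constructor
  · rw [nakagami, integrable_withDensity_iff_integrable_smul'
      (measurable_nakagamiPDF m w).ennreal_ofReal (by simp), e,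
      integrableOn_iff_integrable_of_support_subset hs]
  · rw [nakagami, integral_withDensity_eq_integral_toReal_smul
      (measurable_nakagamiPDF m w).ennreal_ofReal (by simp), e,
      setIntegral_eq_integral_of_forall_compl_eq_zero]
    intro x hx
    by_contra h
    exact hx (hs h)

theorem integrable_nakagami_cpow {m w : ℝ} (hm : 0 < m) (hw : 0 < w) {s : ℂ} (hs : -m < s.re) :
    Integrable (fun x : ℝ => ((x ^ 2 : ℝ) : ℂ) ^ s) (nakagami m w) := by
  rw [(integrable_and_integral_nakagami_iff hm hw _).1]
  refine IntegrableOn.congr_fun (f := fun x : ℝ =>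
    ((2 * m ^ m / (Real.Gamma m * w ^ m) : ℝ) : ℂ) *
        ((x : ℂ) ^ (2 * (m + s) - 1) * Real.exp (-(m / w) * x ^ 2))) ?_
    (fun x hx => (nakagami_moment_integrand s hx).symm) measurableSet_Ioi
  refine Integrable.const_mul ?_ _
  refine Integrable.mono' (integrableOn_rpow_mul_exp_neg_mul_sq_Ioi (r := m / w) (by positivity)
    (a := m + s.re) (by linarith)) ?_ ?_
  · refine Measurable.aestronglyMeasurable ?_
    exact (Complex.measurable_ofReal.pow_const _).mul (by fun_prop)
  · filter_upwards [ae_restrict_mem measurableSet_Ioi] with x hx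
    rw [norm_mul, Complex.norm_cpow_eq_rpow_re_of_pos hx, Complex.norm_real,
      Real.norm_of_nonneg (Real.exp_nonneg _)]
    simp

/-- Multiplying the density by `x ^ (2s)` only shifts the shape in its power of `x` from `m` to `m +
s`; the bound on `s.re` is integrability at `0`. -/
theorem integral_nakagami_cpow {m w : ℝ} (hm : 0 < m) (hw : 0 < w) {s : ℂ} (hs : -m < s.re) :
    ∫ x : ℝ, ((x ^ 2 : ℝ) : ℂ) ^ s ∂nakagami m w =
      Complex.Gamma (m + s) / Real.Gamma m * ((w / m : ℝ) : ℂ) ^ s := by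
  rw [(integrable_and_integral_nakagami_iff hm hw _).2,
    setIntegral_congr_fun measurableSet_Ioi fun x hx => nakagami_moment_integrand s hx,
    integral_const_mul, integral_cpow_mul_exp_neg_mul_sq (by positivity) (by simp; linarith)]
  have hG := (Real.Gamma_pos_of_pos hm).ne'
  have h0 : ((w / m : ℝ) : ℂ) ≠ 0 := by exact_mod_cast (by positivity : w / m ≠ 0)
  have h1 : (1 / ((m / w : ℝ) : ℂ)) = ((w / m : ℝ) : ℂ) := by push_cast; field_simp
  have h2 : (w / m) ^ m = w ^ m / m ^ m := Real.div_rpow hw.le hm.le m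
  have h3 : m ^ m ≠ 0 := by positivity
  have h4 : w ^ m ≠ 0 := by positivity
  rw [h1, Complex.cpow_add _ _ h0, ← Complex.ofReal_cpow (by positivity), h2]
  have hG' : ((Real.Gamma m : ℝ) : ℂ) ≠ 0 := by exact_mod_cast hG
  have h3' : ((m ^ m : ℝ) : ℂ) ≠ 0 := by exact_mod_cast h3
  have h4' : ((w ^ m : ℝ) : ℂ) ≠ 0 := by exact_mod_cast h4
  rw [Complex.ofReal_div, Complex.ofReal_div, Complex.ofReal_mul, Complex.ofReal_mul]
  field_simp
  simp

/-! ### Averaging the Mellin–Barnes formula; laws of products -/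

variable {S : Type*} [MeasurableSpace S] {P : Measure S}

theorem integral_erfc_sqrt_eq_mellinBarnes [IsProbabilityMeasure P] {Y : S → ℝ}
    (hY : AEMeasurable Y P) (hpos : ∀ᵐ ω ∂P, 0 < Y ω) {c : ℝ} (hc : c < 0)
    (hint : Integrable (fun ω => (Y ω : ℂ) ^ (c : ℂ)) P) :
    Integrable (fun t : ℝ => erfcMellin (c + t * Complex.I) *
      ∫ ω, (Y ω : ℂ) ^ (c + t * Complex.I) ∂P) ∧
    ((√Real.pi * ∫ ω, erfc √(Y ω) ∂P : ℝ) : ℂ) = 1 / (2 * Real.pi) *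
      ∫ t : ℝ, erfcMellin (c + t * Complex.I) * ∫ ω, (Y ω : ℂ) ^ (c + t * Complex.I) ∂P := by
  have hK := integrable_erfcMellin hc
  have hprod : Integrable (Function.uncurry fun (t : ℝ) (ω : S) =>
      erfcMellin (c + t * Complex.I) * (Y ω : ℂ) ^ (c + t * Complex.I)) (volume.prod P) := by
    -- For `Y > 0` the norm of `Y ^ (c + i t)` is `Y ^ c`, so a product of integrable functions
    -- dominates.
    refine Integrable.mono (hK.mul_prod hint) ?_ ?_
    · refine hK.aestronglyMeasurable.comp_fst.mul (AEMeasurable.aestronglyMeasurable ?_)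
      have h1 : AEMeasurable (fun p : ℝ × S => ((Y p.2 : ℝ) : ℂ)) (volume.prod P) :=
        Complex.measurable_ofReal.comp_aemeasurable hY.comp_snd
      exact h1.pow (by fun_prop)
    · have : ∀ᵐ p ∂(volume : Measure ℝ).prod P, 0 < Y p.2 :=
        Measure.quasiMeasurePreserving_snd.ae hpos
      filter_upwards [this] with p hp
      simp only [Function.uncurry, norm_mul]
      rw [Complex.norm_cpow_eq_rpow_re_of_pos hp, Complex.norm_cpow_eq_rpow_re_of_pos hp]
      simp
  constructor
  · simpa only [Function.uncurry, integral_const_mul] using hprod.integral_prod_left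
  · simp_rw [← integral_const_mul (μ := P)]
    rw [integral_integral_swap hprod, ← integral_complex_ofReal, ← integral_const_mul (1 / (2 * Real.pi : ℂ))]
    refine integral_congr_ae ?_
    filter_upwards [hpos] with ω hω
    exact erfc_sqrt_eq_mellinBarnes hc hω

/-- The preimage of a null set under `(x, y) ↦ K x y` has null sections for every `x ≠ 0`, hence for
almost every `x`. -/
theorem map_const_mul_mul_absolutelyContinuous [IsFiniteMeasure P] {U V : S → ℝ} {K : ℝ}
    (hK : K ≠ 0) (hU : AEMeasurable U P) (hV : AEMeasurable V P) (hUa : P.map U ≪ volume)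
    (hVa : P.map V ≪ volume) (hUV : IndepFun U V P) :
    P.map (fun ω => K * U ω * V ω) ≪ volume := by
  have hm : Measurable fun p : ℝ × ℝ => K * p.1 * p.2 := by fun_prop
  have h1 : P.map (fun ω => K * U ω * V ω) =
      ((P.map U).prod (P.map V)).map fun p => K * p.1 * p.2 := by
    rw [← (indepFun_iff_map_prod_eq_prod_map_map hU hV).1 hUV,
      AEMeasurable.map_map_of_aemeasurable hm.aemeasurable (hU.prodMk hV)]
    rfl
  rw [h1]
  refine Measure.AbsolutelyContinuous.mk fun s hs hs0 => ?_
  rw [Measure.map_apply hm hs, Measure.measure_prod_null (hm hs)]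
  have hne : ∀ᵐ x ∂P.map U, x ≠ 0 := hUa.ae_le (Measure.ae_ne volume 0)
  filter_upwards [hne] with x hx
  refine hVa ?_
  have : Prod.mk x ⁻¹' ((fun p : ℝ × ℝ => K * p.1 * p.2) ⁻¹' s) = (fun y => K * x * y) ⁻¹' s := rfl
  rw [this, Real.volume_preimage_mul_left (mul_ne_zero hK hx), hs0, mul_zero]

/-! ### Identification with the Meijer G-function -/

theorem separatesPoles_iff {m₁ m₂ c : ℝ} :
    SeparatesPoles 2 2 ![1 - (m₁ : ℂ), 1 - (m₂ : ℂ), 1] ![0, 1 / 2] c ↔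
      c < 0 ∧ -m₁ < c ∧ -m₂ < c := by
  simp only [SeparatesPoles, Fin.forall_fin_succ]
  norm_num
  -- The parameter `1 / 2` asks for `c < 1 / 2`, which `c < 0` implies.
  exact fun _ _ h => h.trans (by norm_num)

/-- The third upper parameter `1` contributes `1 / Γ(1 - s)`, which cancels `Γ(-s)` up to the factor
`1 / (-s)`. -/
theorem meijerIntegrand_eq {m₁ m₂ : ℝ} {z s : ℂ} (hs : s.re < 0) :
    meijerIntegrand 2 2 ![1 - (m₁ : ℂ), 1 - (m₂ : ℂ), 1] ![0, 1 / 2] z s =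
      erfcMellin s * (Complex.Gamma (m₁ + s) * Complex.Gamma (m₂ + s) * z ^ s) := by
  have h0 : -s ≠ 0 := fun h => by
    have := congrArg Complex.re h
    simp at this
    linarith
  have hG : Complex.Gamma (-s) ≠ 0 := Complex.Gamma_ne_zero_of_re_pos (by simpa using hs)
  have h1 : Complex.Gamma (1 - s) = -s * Complex.Gamma (-s) := by
    rw [← Complex.Gamma_add_one _ h0]; ring_nf
  simp only [meijerIntegrand, Fin.prod_univ_succ, erfcMellin]
  simp [h1]
  field_simp

theorem integral_mul_sq_cpow [IsProbabilityMeasure P] {Z₁ Z₂ : S → ℝ} {m₁ w₁ m₂ w₂ k : ℝ}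
    (hm₁ : 0 < m₁) (hw₁ : 0 < w₁) (hm₂ : 0 < m₂) (hw₂ : 0 < w₂) (hk : 0 < k)
    (h₁ : HasLaw Z₁ (nakagami m₁ w₁) P) (h₂ : HasLaw Z₂ (nakagami m₂ w₂) P)
    (hind : IndepFun Z₁ Z₂ P) {s : ℂ} (hs₁ : -m₁ < s.re) (hs₂ : -m₂ < s.re) :
    Integrable (fun ω => ((k * Z₁ ω ^ 2 * Z₂ ω ^ 2 : ℝ) : ℂ) ^ s) P ∧
    ∫ ω, ((k * Z₁ ω ^ 2 * Z₂ ω ^ 2 : ℝ) : ℂ) ^ s ∂P =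
      1 / ((Real.Gamma m₁ : ℂ) * Real.Gamma m₂) * (Complex.Gamma (m₁ + s) *
        Complex.Gamma (m₂ + s) * ((k * (w₁ / m₁) * (w₂ / m₂) : ℝ) : ℂ) ^ s) := by
  have e : (fun ω => ((k * Z₁ ω ^ 2 * Z₂ ω ^ 2 : ℝ) : ℂ) ^ s) = fun ω =>
      (k : ℂ) ^ s * (((Z₁ ω ^ 2 : ℝ) : ℂ) ^ s * ((Z₂ ω ^ 2 : ℝ) : ℂ) ^ s) := by
    funext ω
    -- Principal powers are multiplicative here because all bases are nonnegative reals.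
    rw [Complex.ofReal_mul, Complex.mul_cpow_ofReal_nonneg (by positivity) (by positivity),
      Complex.ofReal_mul, Complex.mul_cpow_ofReal_nonneg hk.le (by positivity), mul_assoc]
  have hf : Measurable fun x : ℝ => ((x ^ 2 : ℝ) : ℂ) ^ s :=
    (Complex.measurable_ofReal.comp (measurable_id.pow_const 2)).pow_const s
  have i₁ : Integrable (fun ω => ((Z₁ ω ^ 2 : ℝ) : ℂ) ^ s) P := by
    have := integrable_nakagami_cpow hm₁ hw₁ hs₁
    rw [← h₁.map_eq, integrable_map_measure hf.aestronglyMeasurable h₁.aemeasurable] at this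
    exact this
  have i₂ : Integrable (fun ω => ((Z₂ ω ^ 2 : ℝ) : ℂ) ^ s) P := by
    have := integrable_nakagami_cpow hm₂ hw₂ hs₂
    rw [← h₂.map_eq, integrable_map_measure hf.aestronglyMeasurable h₂.aemeasurable] at this
    exact this
  have v₁ : ∫ ω, ((Z₁ ω ^ 2 : ℝ) : ℂ) ^ s ∂P =
      Complex.Gamma (m₁ + s) / Real.Gamma m₁ * ((w₁ / m₁ : ℝ) : ℂ) ^ s :=
    (h₁.integral_comp hf.aestronglyMeasurable).trans (integral_nakagami_cpow hm₁ hw₁ hs₁)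
  have v₂ : ∫ ω, ((Z₂ ω ^ 2 : ℝ) : ℂ) ^ s ∂P =
      Complex.Gamma (m₂ + s) / Real.Gamma m₂ * ((w₂ / m₂ : ℝ) : ℂ) ^ s :=
    (h₂.integral_comp hf.aestronglyMeasurable).trans (integral_nakagami_cpow hm₂ hw₂ hs₂)
  rw [e]
  constructor
  · exact ((hind.comp hf hf).integrable_mul i₁ i₂).const_mul _
  · rw [integral_const_mul, hind.integral_fun_comp_mul_comp h₁.aemeasurable h₂.aemeasurable
      (f := fun x : ℝ => ((x ^ 2 : ℝ) : ℂ) ^ s) (g := fun x : ℝ => ((x ^ 2 : ℝ) : ℂ) ^ s)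
      hf.aestronglyMeasurable hf.aestronglyMeasurable, v₁, v₂,
      Complex.ofReal_mul, Complex.mul_cpow_ofReal_nonneg (by positivity) (by positivity),
      Complex.ofReal_mul, Complex.mul_cpow_ofReal_nonneg hk.le (by positivity)]
    ring

/-- The right-hand side does not involve `c`; this is what makes all separating lines agree. -/
theorem meijerLine_eq_integral_erfc [IsProbabilityMeasure P] {Z₁ Z₂ : S → ℝ}
    {m₁ w₁ m₂ w₂ k : ℝ}
    (hm₁ : 0 < m₁) (hw₁ : 0 < w₁) (hm₂ : 0 < m₂) (hw₂ : 0 < w₂) (hk : 0 < k)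
    (h₁ : HasLaw Z₁ (nakagami m₁ w₁) P) (h₂ : HasLaw Z₂ (nakagami m₂ w₂) P)
    (hind : IndepFun Z₁ Z₂ P) {c : ℝ}
    (hc : SeparatesPoles 2 2 ![1 - (m₁ : ℂ), 1 - (m₂ : ℂ), 1] ![0, 1 / 2] c) :
    Integrable (fun t : ℝ => meijerIntegrand 2 2 ![1 - (m₁ : ℂ), 1 - (m₂ : ℂ), 1] ![0, 1 / 2]
      ((k * (w₁ / m₁) * (w₂ / m₂) : ℝ) : ℂ) (c + t * Complex.I)) ∧
    meijerLine 2 2 ![1 - (m₁ : ℂ), 1 - (m₂ : ℂ), 1] ![0, 1 / 2]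
      ((k * (w₁ / m₁) * (w₂ / m₂) : ℝ) : ℂ) c =
      ((Real.Gamma m₁ * Real.Gamma m₂ *
        (√Real.pi * ∫ ω, erfc √(k * Z₁ ω ^ 2 * Z₂ ω ^ 2) ∂P) : ℝ) : ℂ) := by
  obtain ⟨hc0, hc₁, hc₂⟩ := separatesPoles_iff.1 hc
  have hG₁ : (Real.Gamma m₁ : ℂ) ≠ 0 := by exact_mod_cast (Real.Gamma_pos_of_pos hm₁).ne'
  have hG₂ : (Real.Gamma m₂ : ℂ) ≠ 0 := by exact_mod_cast (Real.Gamma_pos_of_pos hm₂).ne'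
  have hm := h₁.aemeasurable
  have hm' := h₂.aemeasurable
  have hpos : ∀ᵐ ω ∂P, 0 < k * Z₁ ω ^ 2 * Z₂ ω ^ 2 := by
    have p₁ : ∀ᵐ ω ∂P, 0 < Z₁ ω :=
      (h₁.ae_iff (p := fun x => 0 < x) (by measurability)).2 (nakagami_ae_pos m₁ w₁)
    have p₂ : ∀ᵐ ω ∂P, 0 < Z₂ ω :=
      (h₂.ae_iff (p := fun x => 0 < x) (by measurability)).2 (nakagami_ae_pos m₂ w₂)
    filter_upwards [p₁, p₂] with ω _ _
    positivity
  obtain ⟨hI, hE⟩ := integral_erfc_sqrt_eq_mellinBarnes (P := P)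
    (Y := fun ω => k * Z₁ ω ^ 2 * Z₂ ω ^ 2) (by fun_prop) hpos hc0
    (integral_mul_sq_cpow hm₁ hw₁ hm₂ hw₂ hk h₁ h₂ hind (s := c)
      (by simpa using hc₁) (by simpa using hc₂)).1
  have e : ∀ t : ℝ, erfcMellin (c + t * Complex.I) *
      ∫ ω, ((k * Z₁ ω ^ 2 * Z₂ ω ^ 2 : ℝ) : ℂ) ^ (c + t * Complex.I) ∂P =
      1 / ((Real.Gamma m₁ : ℂ) * Real.Gamma m₂) *
        meijerIntegrand 2 2 ![1 - (m₁ : ℂ), 1 - (m₂ : ℂ), 1] ![0, 1 / 2]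
          ((k * (w₁ / m₁) * (w₂ / m₂) : ℝ) : ℂ) (c + t * Complex.I) := by
    intro t
    rw [(integral_mul_sq_cpow hm₁ hw₁ hm₂ hw₂ hk h₁ h₂ hind (by simpa using hc₁)
      (by simpa using hc₂)).2, meijerIntegrand_eq (by simpa using hc0)]
    ring
  simp_rw [e] at hI hE
  constructor
  · refine (hI.const_mul ((Real.Gamma m₁ : ℂ) * Real.Gamma m₂)).congr (.of_forall fun t => ?_)
    field_simp
  · rw [Complex.ofReal_mul (_ * _) (√Real.pi * _), hE, meijerLine, integral_const_mul]
    generalize (∫ t : ℝ, meijerIntegrand _ _ _ _ _ (c + t * Complex.I)) = J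
    push_cast
    field_simp

theorem meijerGDefined_and_eq_integral_erfc [IsProbabilityMeasure P] {Z₁ Z₂ : S → ℝ}
    {m₁ w₁ m₂ w₂ k : ℝ}
    (hm₁ : 0 < m₁) (hw₁ : 0 < w₁) (hm₂ : 0 < m₂) (hw₂ : 0 < w₂) (hk : 0 < k)
    (h₁ : HasLaw Z₁ (nakagami m₁ w₁) P) (h₂ : HasLaw Z₂ (nakagami m₂ w₂) P)
    (hind : IndepFun Z₁ Z₂ P) :
    MeijerGDefined 2 2 ![1 - (m₁ : ℂ), 1 - (m₂ : ℂ), 1] ![0, 1 / 2]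
      ((k * (w₁ / m₁) * (w₂ / m₂) : ℝ) : ℂ) ∧
    meijerG 2 2 ![1 - (m₁ : ℂ), 1 - (m₂ : ℂ), 1] ![0, 1 / 2]
      ((k * (w₁ / m₁) * (w₂ / m₂) : ℝ) : ℂ) =
      ((Real.Gamma m₁ * Real.Gamma m₂ *
        (√Real.pi * ∫ ω, erfc √(k * Z₁ ω ^ 2 * Z₂ ω ^ 2) ∂P) : ℝ) : ℂ) := by
  have hline := fun c => meijerLine_eq_integral_erfc hm₁ hw₁ hm₂ hw₂ hk h₁ h₂ hind (c := c)
  have hex : ∃ c, SeparatesPoles 2 2 ![1 - (m₁ : ℂ), 1 - (m₂ : ℂ), 1] ![0, 1 / 2] c := by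
    have hmin : 0 < min m₁ m₂ := lt_min hm₁ hm₂
    have h1 := min_le_left m₁ m₂
    have h2 := min_le_right m₁ m₂
    -- The midpoint of the admissible strip `-min m₁ m₂ < c < 0`.
    exact ⟨-(min m₁ m₂) / 2, separatesPoles_iff.2
      ⟨by linarith, by linarith, by linarith⟩⟩
  have hG : meijerG 2 2 ![1 - (m₁ : ℂ), 1 - (m₂ : ℂ), 1] ![0, 1 / 2]
      ((k * (w₁ / m₁) * (w₂ / m₂) : ℝ) : ℂ) =
      ((Real.Gamma m₁ * Real.Gamma m₂ *
        (√Real.pi * ∫ ω, erfc √(k * Z₁ ω ^ 2 * Z₂ ω ^ 2) ∂P) : ℝ) : ℂ) := by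
    rw [meijerG, dif_pos hex]
    exact (hline _ hex.choose_spec).2
  exact ⟨⟨hex, fun c hc => ⟨(hline c hc).1, (hline c hc).2.trans hG.symm⟩⟩, hG⟩

/-! ### Densities and positivity of the network parameters -/

theorem integral_mul_pdf [IsFiniteMeasure P] {X : S → ℝ} (hX : HasPDF X P volume)
    (hpos : ∀ᵐ ω ∂P, 0 < X ω) {f : ℝ → ℝ} (hf : Measurable f)
    (hint : Integrable (fun ω => f (X ω)) P) :
    IntegrableOn (fun x => f x * (pdf X P volume x).toReal) (Set.Ioi 0) ∧
    ∫ x in Set.Ioi 0, f x * (pdf X P volume x).toReal = ∫ ω, f (X ω) ∂P := by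
  have hm : AEStronglyMeasurable ((Set.Ioi 0).indicator f) volume :=
    (hf.indicator measurableSet_Ioi).aestronglyMeasurable
  constructor
  · refine Integrable.integrableOn ?_
    simpa only [smul_eq_mul, mul_comm] using
      (pdf.integrable_pdf_smul_iff hf.aestronglyMeasurable).2 hint
  · have h := (pdf.integral_pdf_smul hm :
      _ = ∫ ω, (Set.Ioi 0).indicator f (X ω) ∂P)
    have e : (fun x => (pdf X P volume x).toReal • (Set.Ioi 0).indicator f x) =
        (Set.Ioi 0).indicator fun x => f x * (pdf X P volume x).toReal := by
      funext x
      by_cases hx : x ∈ Set.Ioi 0 <;> simp [hx, mul_comm]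
    rw [e, integral_indicator measurableSet_Ioi] at h
    rw [h]
    refine integral_congr_ae ?_
    filter_upwards [hpos] with ω hω
    exact Set.indicator_of_mem (Set.mem_Ioi.2 hω) f

/-- The spread is a product of squares, and if it vanished so would the numerator of the shape. -/
theorem spreadBar_pos_of_shapeBar_pos {N : ℕ} {κ m w : ℝ} (h : 0 < shapeBar N κ m w) :
    0 < spreadBar κ m w := by
  have h0 : 0 ≤ spreadBar κ m w := by unfold spreadBar; positivity
  refine lt_of_le_of_ne h0 fun h1 => ?_
  simp [shapeBar, ← h1] at h

theorem Modulation.beta_pos (μ : Modulation) : 0 < μ.beta := by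
  rcases μ with _ | _ | ⟨M, hM⟩ | ⟨M, hM⟩
  · norm_num [Modulation.beta]
  · norm_num [Modulation.beta]
  · have h2 : (2 : ℝ) ≤ M := by exact_mod_cast hM
    have : 0 < Real.sin (Real.pi / M) :=
      Real.sin_pos_of_pos_of_lt_pi (by positivity) (div_lt_self Real.pi_pos (by linarith))
    simp only [Modulation.beta]
    positivity
  · have h2 : (2 : ℝ) ≤ M := by exact_mod_cast hM
    simp only [Modulation.beta]
    exact div_pos (by norm_num) (by linarith)

theorem Network.lc_pos (R : Network) : 0 < R.lc := by
  refine Finset.prod_pos fun i hi => mul_pos R.C₀_pos ?_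
  exact Real.rpow_pos_of_pos (div_pos (R.d_pos i hi) R.d₀_pos) _

theorem Network.G_pos (R : Network) : 0 < R.G := mul_pos R.Gt_pos R.Gr_pos

theorem Network.prod_N_pos (R : Network) : 0 < ∏ i ∈ Finset.Icc 1 R.L, (R.N i : ℝ) :=
  Finset.prod_pos fun i hi => by exact_mod_cast R.N_pos i hi

end CascadedRIS

/-! ### The average symbol error probability -/

theorem proposition4 (R : Network) (hm₁ : 0 < R.mBar₁) (hmL : 0 < R.mBarL)
    {S : Type*} [MeasurableSpace S] (P : Measure S) [IsProbabilityMeasure P] (Z₁ ZL X : S → ℝ)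
    (hZ₁ : HasLaw Z₁ (nakagami R.mBar₁ R.wBar₁) P)
    (hZL : HasLaw ZL (nakagami R.mBarL R.wBarL) P)
    (hind : IndepFun Z₁ ZL P)
    (hX : ∀ s, X s = √(R.snr (Z₁ s) (ZL s))) :
    HasPDF X P volume ∧
    (∀ α β : ℝ, 0 < β →
      IntegrableOn (fun x => α * gaussianQ (√β * x) * (pdf X P volume x).toReal) (Set.Ioi 0) ∧
      MeijerGDefined 2 2 ![1 - (R.mBar₁ : ℂ), 1 - (R.mBarL : ℂ), 1] ![0, 1 / 2]
        ((β * R.Pt * R.G * R.lc * (∏ i ∈ Finset.Icc 1 R.L, (R.N i : ℝ) ^ 2) /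
          (2 * R.σ ^ 2 * (R.mBar₁ * R.mBarL / (R.wBar₁ * R.wBarL))) : ℝ) : ℂ) ∧
      (averageSEP P X α β : ℂ) =
        ((α / (2 * √Real.pi * Real.Gamma R.mBar₁ * Real.Gamma R.mBarL) : ℝ) : ℂ) *
        meijerG 2 2 ![1 - (R.mBar₁ : ℂ), 1 - (R.mBarL : ℂ), 1] ![0, 1 / 2]
          ((β * R.Pt * R.G * R.lc * (∏ i ∈ Finset.Icc 1 R.L, (R.N i : ℝ) ^ 2) /
            (2 * R.σ ^ 2 * (R.mBar₁ * R.mBarL / (R.wBar₁ * R.wBarL))) : ℝ) : ℂ)) ∧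
    (∀ μ : Modulation, 0 < μ.beta ∧
      (averageSEP P X μ.alpha μ.beta : ℂ) =
        ((μ.alpha / (2 * √Real.pi * Real.Gamma R.mBar₁ * Real.Gamma R.mBarL) : ℝ) : ℂ) *
        meijerG 2 2 ![1 - (R.mBar₁ : ℂ), 1 - (R.mBarL : ℂ), 1] ![0, 1 / 2]
          ((μ.beta * R.Pt * R.G * R.lc * (∏ i ∈ Finset.Icc 1 R.L, (R.N i : ℝ) ^ 2) /
            (2 * R.σ ^ 2 * (R.mBar₁ * R.mBarL / (R.wBar₁ * R.wBarL))) : ℝ) : ℂ)) := by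
  have hw₁ : 0 < R.wBar₁ := spreadBar_pos_of_shapeBar_pos hm₁
  have hwL : 0 < R.wBarL := spreadBar_pos_of_shapeBar_pos hmL
  have hl := R.lc_pos
  have hG := R.G_pos
  have hPt := R.Pt_pos
  have hσ := R.σ_pos
  have hN := R.prod_N_pos
  set A : ℝ := R.Pt / R.σ ^ 2 * R.lc * R.G * (∏ i ∈ Finset.Icc 1 R.L, (R.N i : ℝ)) ^ 2 with hA
  have hA0 : 0 < A := by positivity
  have p₁ : ∀ᵐ s ∂P, 0 < Z₁ s :=
    (hZ₁.ae_iff (p := fun x => 0 < x) (by measurability)).2 (nakagami_ae_pos _ _)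
  have pL : ∀ᵐ s ∂P, 0 < ZL s :=
    (hZL.ae_iff (p := fun x => 0 < x) (by measurability)).2 (nakagami_ae_pos _ _)
  -- The square root of the SNR is a priori an absolute value; almost sure positivity of the
  -- amplitudes removes it.
  have hXA : ∀ᵐ s ∂P, X s = √A * Z₁ s * ZL s := by
    filter_upwards [p₁, pL] with s h₁ hL
    rw [hX, Network.snr, show R.Pt / R.σ ^ 2 * R.lc * R.G *
      ((∏ i ∈ Finset.Icc 1 R.L, (R.N i : ℝ)) * Z₁ s * ZL s) ^ 2 = A * (Z₁ s * ZL s) ^ 2 by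
        rw [hA]; ring, Real.sqrt_mul hA0.le, Real.sqrt_sq (by positivity), mul_assoc]
  have hXpos : ∀ᵐ s ∂P, 0 < X s := by
    filter_upwards [p₁, pL, hXA] with s h₁ hL h
    rw [h]
    positivity
  have hpdf : HasPDF X P volume := by
    rw [HasPDF.congr_iff hXA, Real.hasPDF_iff]
    have a₁ := hZ₁.aemeasurable
    have aL := hZL.aemeasurable
    refine ⟨by fun_prop, map_const_mul_mul_absolutelyContinuous (by positivity) a₁ aL ?_ ?_ hind⟩
    · rw [hZ₁.map_eq]; exact nakagami_absolutelyContinuous _ _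
    · rw [hZL.map_eq]; exact nakagami_absolutelyContinuous _ _
  have main : ∀ α β : ℝ, 0 < β →
      IntegrableOn (fun x => α * gaussianQ (√β * x) * (pdf X P volume x).toReal) (Set.Ioi 0) ∧
      MeijerGDefined 2 2 ![1 - (R.mBar₁ : ℂ), 1 - (R.mBarL : ℂ), 1] ![0, 1 / 2]
        ((β * R.Pt * R.G * R.lc * (∏ i ∈ Finset.Icc 1 R.L, (R.N i : ℝ) ^ 2) /
          (2 * R.σ ^ 2 * (R.mBar₁ * R.mBarL / (R.wBar₁ * R.wBarL))) : ℝ) : ℂ) ∧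
      (averageSEP P X α β : ℂ) =
        ((α / (2 * √Real.pi * Real.Gamma R.mBar₁ * Real.Gamma R.mBarL) : ℝ) : ℂ) *
        meijerG 2 2 ![1 - (R.mBar₁ : ℂ), 1 - (R.mBarL : ℂ), 1] ![0, 1 / 2]
          ((β * R.Pt * R.G * R.lc * (∏ i ∈ Finset.Icc 1 R.L, (R.N i : ℝ) ^ 2) /
            (2 * R.σ ^ 2 * (R.mBar₁ * R.mBarL / (R.wBar₁ * R.wBarL))) : ℝ) : ℂ) := by
    intro α β hβ
    have hQ : Continuous fun x => α * gaussianQ (√β * x) := by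
      unfold gaussianQ
      have := continuous_erfc
      fun_prop
    have hXm : AEMeasurable X P := hpdf.aemeasurable
    have hint : Integrable (fun s => α * gaussianQ (√β * X s)) P := by
      refine Integrable.of_bound (C := |α|)
        (hQ.measurable.comp_aemeasurable hXm).aestronglyMeasurable (.of_forall fun s => ?_)
      rw [norm_mul, Real.norm_eq_abs, Real.norm_eq_abs]
      refine mul_le_of_le_one_right (abs_nonneg α) ?_
      have h0 := erfc_nonneg (√β * X s / √2)
      have h2 := erfc_le_two (√β * X s / √2)
      rw [gaussianQ, abs_of_nonneg (by positivity)]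
      linarith
    obtain ⟨hi, hv⟩ := integral_mul_pdf hpdf hXpos hQ.measurable hint
    -- The value of `k` comes from `Q(√β x) = erfc √(β x² / 2) / 2` for `x ≥ 0`, with `x² = A Z₁²
    -- Z_L²`.
    obtain ⟨hd, hg⟩ := meijerGDefined_and_eq_integral_erfc hm₁ hw₁ hmL hwL
      (k := β * A / 2) (by positivity) hZ₁ hZL hind
    have hz : β * A / 2 * (R.wBar₁ / R.mBar₁) * (R.wBarL / R.mBarL) =
        β * R.Pt * R.G * R.lc * (∏ i ∈ Finset.Icc 1 R.L, (R.N i : ℝ) ^ 2) /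
          (2 * R.σ ^ 2 * (R.mBar₁ * R.mBarL / (R.wBar₁ * R.wBarL))) := by
      rw [hA, Finset.prod_pow]
      field_simp
    rw [hz] at hd hg
    refine ⟨hi, hd, ?_⟩
    have hE : ∫ s, α * gaussianQ (√β * X s) ∂P =
        α / 2 * ∫ s, erfc √(β * A / 2 * Z₁ s ^ 2 * ZL s ^ 2) ∂P := by
      rw [← integral_const_mul]
      refine integral_congr_ae ?_
      filter_upwards [p₁, pL, hXA] with s h₁ hL h
      have : √(β * A / 2 * Z₁ s ^ 2 * ZL s ^ 2) = √β * X s / √2 := by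
        rw [h, show β * A / 2 * Z₁ s ^ 2 * ZL s ^ 2 = β * A / 2 * (Z₁ s * ZL s) ^ 2 by ring,
          Real.sqrt_mul (by positivity), Real.sqrt_div (by positivity), Real.sqrt_mul hβ.le,
          Real.sqrt_sq (by positivity)]
        ring
      simp only [gaussianQ, this]
      ring
    rw [hg, averageSEP, hv, hE, ← Complex.ofReal_mul]
    have hG₁ := Real.Gamma_pos_of_pos hm₁
    have hGL := Real.Gamma_pos_of_pos hmL
    congr 1
    field_simp
  exact ⟨hpdf, main, fun μ => ⟨μ.beta_pos, (main μ.alpha μ.beta μ.beta_pos).2.2⟩⟩
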